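/- Let $-1\le q\le 1$, $\theta\in\mathbb R$, $\tau\ge 0$, and write $[n]_q=1+q+\dots+q^{n-1}$, $[0]_q=0$. For $x\in\mathbb R$ and $0\le s<t$ let $Q_n(y)=Q_n(y|x,s,t)$ be the monic polynomials in $y$ given by $Q_0=1$, $Q_1(y)=y-x$ and, for $n\ge1$, $$y\,Q_n(y)=Q_{n+1}(y)+(\theta[n]_q+xq^n)\,Q_n(y)+(t-sq^{n-1}+\tau[n-1]_q)\,[n]_q\,Q_{n-1}(y),$$ and let $\mu_{x,s,t}$ be the (unique) probability measure on $\mathbb R$ with finite moments of all orders with respect to which the $Q_n(\cdot|x,s,t)$ are orthogonal. Let $(X_t)_{t\ge0}$ be a real Markov process with $X_0=0$ almost surely and transition probabilities $\mu_{x,s,t}$, that is, $P(X_t\in A\mid\mathcal F_{\le s})=\mu_{X_s,s,t}(A)$ almost surely for all $0\le s<t$ and all Borel sets $A$. Here $\mathcal F_{\le s}=\sigma(X_r: r\le s)$ and $\mathcal F_{\le s}\vee\mathcal F_{\ge u}=\sigma(X_r: r\in[0,s]\cup[u,\infty))$. Then $X_t$ is square integrable for every $t\ge0$, and the following hold (equalities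 of conditional expectations being almost sure). 1. $E(X_t)=0$ and $E(X_tX_s)=\min\{t,s\}$ for all $s,t\ge0$. 2. For all $0\le s<t<u$, $\;E(X_t\mid\mathcal F_{\le s}\vee\mathcal F_{\ge u})=\frac{u-t}{u-s}X_s+\frac{t-s}{u-s}X_u$. 3. For all $0\le s\le t$, $\;E(X_t^2\mid\mathcal F_{\le s})=X_s^2+t-s$. 4. For all $0\le s<t<u$, $$\mathrm{Var}(X_t\mid\mathcal F_{\le s}\vee\mathcal F_{\ge u})=\frac{(u-t)(t-s)}{u+\tau-qs}\left((1-q)\frac{(X_u-X_s)(sX_u-uX_s)}{(u-s)^2}+\tau\frac{(X_u-X_s)^2}{(u-s)^2}+\theta\frac{X_u-X_s}{u-s}+1\right).$$ 5. Equivalently, for all $0\le s<t<u$, $$E(X_t^2\mid\mathcal F_{\le s}\vee\mathcal F_{\ge u})=AX_s^2+BX_sX_u+CX_u^2+D+\alpha X_s+\beta X_u,$$ where $$A=\frac{u-t}{u-s}\cdot\frac{u+\tau-qt}{u+\tau-qs},\qquad B=(1+q)\,\frac{t-s}{u-s}\cdot\frac{u-t}{u+\tau-qs},\qquad C=\frac{t-s}{u-s}\cdot\frac{t+\tau-qs}{u+\tau-qs},$$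 $$D=\frac{(u-t)(t-s)}{u+\tau-qs},\qquad \alpha=-\theta\,\frac{(u-t)(t-s)}{(u-s)(u+\tau-qs)},\qquad \beta=\theta\,\frac{(u-t)(t-s)}{(u-s)(u+\tau-qs)}.$$ -/

import Mathlib

open MeasureTheory ProbabilityTheory
open scoped NNReal

noncomputable section

namespace QMeixner

/-- The `q`-integer `[n]_q = 1 + q + ⋯ + q^(n-1)`. -/
def qInt (q : ℝ) (n : ℕ) : ℝ := ∑ i ∈ Finset.range n, q ^ i

/-- The monic polynomials `Q_n(y | x, s, t)` in the variable `y`: `Q_0 = 1`, `Q_1 = y - x`, and for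
`n ≥ 1`
`y Q_n = Q_{n+1} + (θ [n]_q + x q^n) Q_n + (t - s q^(n-1) + τ [n-1]_q) [n]_q Q_{n-1}`. -/
def Q (q θ τ x s t : ℝ) : ℕ → Polynomial ℝ
  | 0 => 1
  | 1 => Polynomial.X - Polynomial.C x
  | n + 2 =>
      (Polynomial.X - Polynomial.C (θ * qInt q (n + 1) + x * q ^ (n + 1))) * Q q θ τ x s t (n + 1)
        - Polynomial.C ((t - s * q ^ n + τ * qInt q n) * qInt q (n + 1)) * Q q θ τ x s t n

/-- `μ` is a probability measure with all moments finite, for which the polynomials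
`Q_n(· | x, s, t)` are orthogonal. -/
structure Orthogonalizes (q θ τ x s t : ℝ) (μ : Measure ℝ) : Prop where
  isProbabilityMeasure : IsProbabilityMeasure μ
  integrable_pow : ∀ n : ℕ, Integrable (fun y : ℝ => y ^ n) μ
  orthogonal : ∀ m n : ℕ, m ≠ n →
    ∫ y, (Q q θ τ x s t m).eval y * (Q q θ τ x s t n).eval y ∂μ = 0

open Classical in
/-- The measure `μ_{x,s,t}`: the probability measure orthogonalizing the polynomials
`Q_n(· | x, s, t)`. (Where no such measure exists, the value is the zero measure, which is not a
probability measure. For `0 ≤ s < t`, `τ ≥ 0`, `-1 ≤ q ≤ 1` there is exactly one.) -/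
def transitionMeasure (q θ τ x s t : ℝ) : Measure ℝ :=
  if h : ∃ μ : Measure ℝ, Orthogonalizes q θ τ x s t μ then h.choose else 0

variable {Ω : Type*}

/-- The σ-field generated by the random variables `X_r`, `r ∈ T`. -/
abbrev sigmaField (X : ℝ≥0 → Ω → ℝ) (T : Set ℝ≥0) : MeasurableSpace Ω :=
  ⨆ r ∈ T, (borel ℝ).comap (X r)

/-- `𝓕_{≤ s}`, generated by `X_r`, `r ∈ [0, s]`. -/
abbrev past (X : ℝ≥0 → Ω → ℝ) (s : ℝ≥0) : MeasurableSpace Ω :=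
  sigmaField X (Set.Iic s)

/-- `𝓕_{≤ s} ∨ 𝓕_{≥ u}`, generated by `X_r`, `r ∈ [0, s] ∪ [u, ∞)`. -/
abbrev pastFuture (X : ℝ≥0 → Ω → ℝ) (s u : ℝ≥0) : MeasurableSpace Ω :=
  sigmaField X (Set.Iic s ∪ Set.Ici u)

/-- The real process `(X_t)_{t ≥ 0}` is a Markov process with `X_0 = 0` and with transition
probabilities `κ s t x (dy)`, `s < t`:
`P(X_t ∈ A | 𝓕_{≤ s}) = κ s t (X_s) (A)` almost surely, for all `s < t` and all Borel sets `A`. -/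
structure IsMarkovFromZero [MeasurableSpace Ω] (P : Measure Ω) (X : ℝ≥0 → Ω → ℝ)
    (κ : ℝ≥0 → ℝ≥0 → ℝ → Measure ℝ) : Prop where
  measurable : ∀ t, Measurable (X t)
  zero : ∀ᵐ ω ∂P, X 0 ω = 0
  transition : ∀ s t : ℝ≥0, s < t → ∀ A : Set ℝ, MeasurableSet A →
    P[(X t ⁻¹' A).indicator (fun _ => (1 : ℝ)) | past X s] =ᵐ[P]
      fun ω => (κ s t (X s ω)).real A

/- Coefficients of the conditional second moment given the past and the future. -/

def coeffA (q τ s t u : ℝ) : ℝ := (u - t) / (u - s) * ((u + τ - q * t) / (u + τ - q * s))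

def coeffB (q τ s t u : ℝ) : ℝ := (1 + q) * ((t - s) / (u - s)) * ((u - t) / (u + τ - q * s))

def coeffC (q τ s t u : ℝ) : ℝ := (t - s) / (u - s) * ((t + τ - q * s) / (u + τ - q * s))

def coeffD (q τ s t u : ℝ) : ℝ := (u - t) * (t - s) / (u + τ - q * s)

def coeffAlpha (q θ τ s t u : ℝ) : ℝ :=
  -θ * ((u - t) * (t - s) / ((u - s) * (u + τ - q * s)))

def coeffBeta (q θ τ s t u : ℝ) : ℝ :=
  θ * ((u - t) * (t - s) / ((u - s) * (u + τ - q * s)))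

end QMeixner

end

/-!
The convolution identity `eval_Q_eq_sum` expands `Q_n(y | 0, 0, t)` in the polynomials
`Q_k(y | x, s, t)`, with the coefficient of `Q_0` equal to `Q_n(x | 0, 0, s)`. Since the measure
`μ_{x,s,t}` annihilates `Q_k(· | x, s, t)` for `k ≥ 1`, the process `M_n(t) = Q_n(X_t | 0, 0, t)` is a
martingale for every `n` (`IsMarkovFromZero.hasMartingalePolynomials`).

Let `W` be a random variable with moments of all orders, depending on the past of `s`, and let
`m_n = E(W M_n(s))`. For `s ≤ r ≤ r' ≤ u`, the martingale property and the three-term recurrence express `E(W X_r M_n(u))` and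
`E(W X_r X_{r'} M_n(u))` by the Jacobi operators `J_r` applied to the sequence `m`
(`HasMartingalePolynomials.integral_mul_X_mul_X_mul_eval`). Hence the conditional moments, tested
against `W` and polynomials in `X_u`, reduce to operator identities: `J_t` is affine in `t`, which
gives the linear regression (`jacobi_interpolate`), and `J_t²` is the combination of `J_s²`,
`J_u J_s`, `J_u²`, `J_s`, `J_u` and `1` with the coefficients `A, …, β` (`jacobi_jacobi`).

It remains to replace polynomials in `X_u` by events of the future. The moments of the law
`μ_{0,0,u}` of `X_u` satisfy `|∫ yⁿ| ≤ Cⁿ n!`, so `X_u` has exponential moments, and a square integrable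
variable orthogonal to all powers of `X_u` is orthogonal to `σ(X_u)` (`setIntegral_preimage_eq_zero`).
A variable depending on the past of `u` and orthogonal to all `M_n(u)` is, by the martingale
property, orthogonal to all `M_n(v)` with `v ≥ u`; going through the times of a cylinder event one by
one, it is orthogonal to all events of the future (`Annihilates.setIntegral_biInter`). No regularity
of `x ↦ μ_{x,s,t}` is used, and the existence of the measures `μ_{X_s,s,t}` almost surely is read off
from the total mass of the transition probabilities (`IsMarkovFromZero.ae_orthogonalizes`).
-/

open Filter Topology
open Finset.HasAntidiagonal (antidiagonal mem_antidiagonal)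

namespace QMeixner

/-! ### q-integers and q-binomial coefficients -/

section QCalculus

variable (q : ℝ)

@[simp] lemma qInt_zero : qInt q 0 = 0 := by simp [qInt]

lemma qInt_succ (n : ℕ) : qInt q (n + 1) = qInt q n + q ^ n := by
  simp [qInt, Finset.sum_range_succ]

lemma qInt_add (m n : ℕ) : qInt q (m + n) = qInt q m + q ^ m * qInt q n := by
  induction n with
  | zero => simp
  | succ n ih => rw [← add_assoc, qInt_succ, qInt_succ, ih, pow_add]; ring

lemma qInt_succ' (n : ℕ) : qInt q (n + 1) = 1 + q * qInt q n := by
  rw [add_comm, qInt_add]; simp [qInt]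

lemma abs_qInt_le {q : ℝ} (hq : |q| ≤ 1) (n : ℕ) : |qInt q n| ≤ n := by
  refine (Finset.abs_sum_le_sum_abs _ _).trans ?_
  refine (Finset.sum_le_card_nsmul _ _ 1 fun i _ => ?_).trans (by simp)
  rw [abs_pow]
  exact pow_le_one₀ (abs_nonneg q) hq

/-- The `q`-binomial coefficient `[j + k choose k]_q`, indexed symmetrically by the two parts
`j` and `k`, and defined by the `q`-Pascal recursion (so that it is meaningful at roots of unity,
where the quotient of `q`-factorials is not). -/
noncomputable def qBinom : ℕ → ℕ → ℝ
  | 0, _ => 1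
  | _ + 1, 0 => 1
  | j + 1, k + 1 => qBinom (j + 1) k + q ^ (k + 1) * qBinom j (k + 1)

@[simp] lemma qBinom_zero_left (k : ℕ) : qBinom q 0 k = 1 := by rw [qBinom]

@[simp] lemma qBinom_zero_right (j : ℕ) : qBinom q j 0 = 1 := by cases j <;> rw [qBinom]

lemma qBinom_succ_succ (j k : ℕ) :
    qBinom q (j + 1) (k + 1) = qBinom q (j + 1) k + q ^ (k + 1) * qBinom q j (k + 1) := by
  rw [qBinom]

/-- The two absorption identities, proved together because each is used in the induction step
of the other. -/
lemma qBinom_absorb (j k : ℕ) :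
    qBinom q j (k + 1) * qInt q (k + 1) = qInt q (j + k + 1) * qBinom q j k ∧
      qBinom q (j + 1) k * qInt q (j + 1) = qInt q (j + k + 1) * qBinom q j k := by
  induction h : j + k using Nat.strong_induction_on generalizing j k with
  | _ n ih =>
    subst h
    constructor
    · cases j with
      | zero => simp
      | succ j =>
        obtain ⟨h1, h2⟩ := ih (j + k) (by omega) j k rfl
        have h3 := qInt_add q (k + 1) (j + 1)
        rw [show j + 1 + k + 1 = k + 1 + (j + 1) by ring, h3, qBinom_succ_succ]
        linear_combination q ^ (k + 1) * h1 - q ^ (k + 1) * h2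
    · cases k with
      | zero => simp
      | succ k =>
        obtain ⟨h1, h2⟩ := ih (j + k) (by omega) j k rfl
        have h3 := qInt_add q (k + 1) (j + 1)
        rw [show j + (k + 1) + 1 = k + 1 + (j + 1) by ring, h3, qBinom_succ_succ]
        linear_combination h2 - h1

/-- The `q`-Pascal rule for weighted sums over an antidiagonal. -/
lemma sum_antidiagonal_qBinom_succ (f : ℕ → ℕ → ℝ) (n : ℕ) :
    ∑ p ∈ antidiagonal (n + 1), qBinom q p.1 p.2 * f p.1 p.2 =
      ∑ p ∈ antidiagonal n, qBinom q p.1 p.2 * f p.1 (p.2 + 1) +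
        ∑ p ∈ antidiagonal n, qBinom q p.1 p.2 * q ^ p.2 * f (p.1 + 1) p.2 := by
  -- The two terms of the `q`-Pascal recursion, extended by `0` to the boundary, where one is absent.
  let a : ℕ × ℕ → ℝ := fun p => (if p.2 = 0 then 0 else qBinom q p.1 (p.2 - 1)) * f p.1 p.2
  let b : ℕ × ℕ → ℝ := fun p =>
    (if p.1 = 0 then 0 else qBinom q (p.1 - 1) p.2 * q ^ p.2) * f p.1 p.2
  have hsplit : ∀ p ∈ antidiagonal (n + 1),
      qBinom q p.1 p.2 * f p.1 p.2 = a p + b p := by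
    rintro ⟨j, k⟩ hp
    rw [mem_antidiagonal] at hp
    rcases j with _ | j <;> rcases k with _ | k
    · simp at hp
    · simp [a, b]
    · simp [a, b]
    · simp only [a, b, qBinom_succ_succ]; simp; ring
  rw [Finset.sum_congr rfl hsplit, Finset.sum_add_distrib]
  congr 1
  · rw [Finset.Nat.sum_antidiagonal_succ']; simp [a]
  · rw [Finset.Nat.sum_antidiagonal_succ]; simp [b]

end QCalculus

/-! ### The polynomials `Q_n` and their convolution identity -/

section Polynomials

variable (q θ τ : ℝ)

@[simp] lemma Q_zero (x s t : ℝ) : Q q θ τ x s t 0 = 1 := rfl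

lemma Q_one (x s t : ℝ) : Q q θ τ x s t 1 = Polynomial.X - Polynomial.C x := rfl

/-- The three-term recurrence at all `n`. At `n = 0` the truncated indices are harmless, as the last
coefficient contains the factor `[0]_q = 0`. -/
lemma mul_eval_Q (x s t y : ℝ) (n : ℕ) :
    y * (Q q θ τ x s t n).eval y = (Q q θ τ x s t (n + 1)).eval y
      + (θ * qInt q n + x * q ^ n) * (Q q θ τ x s t n).eval y
      + (t - s * q ^ (n - 1) + τ * qInt q (n - 1)) * qInt q n
        * (Q q θ τ x s t (n - 1)).eval y := by
  cases n with
  | zero => simp [Q_one]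
  | succ n =>
    have h : (Q q θ τ x s t (n + 2)) =
      (Polynomial.X - Polynomial.C (θ * qInt q (n + 1) + x * q ^ (n + 1))) * Q q θ τ x s t (n + 1)
        - Polynomial.C ((t - s * q ^ n + τ * qInt q n) * qInt q (n + 1)) * Q q θ τ x s t n := rfl
    rw [show n + 1 + 1 = n + 2 from rfl, h]
    simp only [Nat.add_sub_cancel, Polynomial.eval_sub, Polynomial.eval_mul, Polynomial.eval_X,
      Polynomial.eval_C]
    ring

/-- The convolution identity behind the Chapman–Kolmogorov equations: composing a step from
`(s₀, x₀)` to `(s, x)` with a step from `(s, x)` to `(t, y)`. -/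
theorem eval_Q_eq_sum (x₀ s₀ x s t y : ℝ) (n : ℕ) :
    (Q q θ τ x₀ s₀ t n).eval y = ∑ p ∈ antidiagonal n,
      qBinom q p.1 p.2 * ((Q q θ τ x₀ s₀ s p.1).eval x * (Q q θ τ x s t p.2).eval y) := by
  set A : ℕ → ℝ := fun j => (Q q θ τ x₀ s₀ s j).eval x with hA
  set B : ℕ → ℝ := fun k => (Q q θ τ x s t k).eval y with hB
  set S : ℕ → ℝ := fun n => ∑ p ∈ antidiagonal n, qBinom q p.1 p.2 * (A p.1 * B p.2) with hS
  change _ = S n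
  have hAr : ∀ j, x * A j = A (j + 1) + (θ * qInt q j + x₀ * q ^ j) * A j
      + (s - s₀ * q ^ (j - 1) + τ * qInt q (j - 1)) * qInt q j * A (j - 1) :=
    mul_eval_Q q θ τ x₀ s₀ s x
  have hBr : ∀ k, y * B k = B (k + 1) + (θ * qInt q k + x * q ^ k) * B k
      + (t - s * q ^ (k - 1) + τ * qInt q (k - 1)) * qInt q k * B (k - 1) :=
    mul_eval_Q q θ τ x s t y
  have hrec : ∀ n, y * S (n + 1) = S (n + 2) + (θ * qInt q (n + 1) + x₀ * q ^ (n + 1)) * S (n + 1)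
      + (t - s₀ * q ^ n + τ * qInt q n) * qInt q (n + 1) * S n := by
    intro n
    have hterm : ∀ p ∈ antidiagonal (n + 1), y * (qBinom q p.1 p.2 * (A p.1 * B p.2)) =
        qBinom q p.1 p.2 * (A p.1 * B (p.2 + 1)) + qBinom q p.1 p.2 * q ^ p.2 * (A (p.1 + 1) * B p.2)
        + (θ * qInt q (n + 1) + x₀ * q ^ (n + 1)) * (qBinom q p.1 p.2 * (A p.1 * B p.2))
        + qBinom q p.1 p.2 * qInt q p.2 * ((t - s * q ^ (p.2 - 1) + τ * qInt q (p.2 - 1)) *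
            (A p.1 * B (p.2 - 1)))
        + qBinom q p.1 p.2 * qInt q p.1 * (q ^ p.2 *
            (s - s₀ * q ^ (p.1 - 1) + τ * qInt q (p.1 - 1)) * (A (p.1 - 1) * B p.2)) := by
      rintro ⟨j, k⟩ hp
      rw [mem_antidiagonal] at hp
      simp only at hp ⊢
      have h1 := qInt_add q k j
      rw [show n + 1 = k + j by omega, h1, pow_add]
      linear_combination qBinom q j k * A j * hBr k + qBinom q j k * q ^ k * B k * hAr j
    have hlow1 : ∑ p ∈ antidiagonal (n + 1), qBinom q p.1 p.2 * qInt q p.2 *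
        ((t - s * q ^ (p.2 - 1) + τ * qInt q (p.2 - 1)) * (A p.1 * B (p.2 - 1))) =
        ∑ p ∈ antidiagonal n, qInt q (n + 1) * qBinom q p.1 p.2 *
          ((t - s * q ^ p.2 + τ * qInt q p.2) * (A p.1 * B p.2)) := by
      rw [Finset.Nat.sum_antidiagonal_succ']
      simp only [qInt_zero, mul_zero, zero_mul, zero_add, Nat.add_sub_cancel]
      refine Finset.sum_congr rfl ?_
      rintro ⟨j, k⟩ hp
      rw [mem_antidiagonal] at hp
      simp only at hp ⊢
      rw [(qBinom_absorb q j k).1, hp]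
    have hlow2 : ∑ p ∈ antidiagonal (n + 1), qBinom q p.1 p.2 * qInt q p.1 * (q ^ p.2 *
        (s - s₀ * q ^ (p.1 - 1) + τ * qInt q (p.1 - 1)) * (A (p.1 - 1) * B p.2)) =
        ∑ p ∈ antidiagonal n, qInt q (n + 1) * qBinom q p.1 p.2 * (q ^ p.2 *
          (s - s₀ * q ^ p.1 + τ * qInt q p.1) * (A p.1 * B p.2)) := by
      rw [Finset.Nat.sum_antidiagonal_succ]
      simp only [qInt_zero, mul_zero, zero_mul, zero_add, Nat.add_sub_cancel]
      refine Finset.sum_congr rfl ?_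
      rintro ⟨j, k⟩ hp
      rw [mem_antidiagonal] at hp
      simp only at hp ⊢
      rw [(qBinom_absorb q j k).2, hp]
    have hpascal := sum_antidiagonal_qBinom_succ q (fun j k => A j * B k) (n + 1)
    simp only [hS, Finset.mul_sum]
    rw [Finset.sum_congr rfl hterm]
    simp only [Finset.sum_add_distrib]
    rw [hlow1, hlow2, ← hpascal, add_assoc, ← Finset.sum_add_distrib]
    congr 1
    refine Finset.sum_congr rfl ?_
    rintro ⟨j, k⟩ hp
    rw [mem_antidiagonal] at hp
    simp only at hp ⊢
    have h1 := qInt_add q k j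
    rw [← show k + j = n by omega, h1, pow_add]
    ring
  induction n using Nat.twoStepInduction with
  | zero => simp [hS, hA, hB]
  | one =>
    have h : S 1 = B 1 + A 1 := by
      simp only [hS]; rw [Finset.Nat.sum_antidiagonal_succ]; simp [hA, hB]
    rw [h]; simp [hA, hB, Q_one]
  | more n ih0 ih1 =>
    have h1 := mul_eval_Q q θ τ x₀ s₀ t y (n + 1)
    have h2 := hrec n
    rw [Nat.add_sub_cancel, ih0, ih1, h2] at h1
    linarith

end Polynomials

/-! ### Determinacy in the presence of exponential moments -/

section Determinacy

variable {Ω : Type*} {mΩ : MeasurableSpace Ω}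

/-- If `exp (c |X|)` is integrable for some `c > 0` under two finite measures that give `X` the same
moments, then `X` has the same law under both: the moments are the Taylor coefficients at `0` of
the complex moment generating functions, which are holomorphic on a strip around the imaginary
axis. -/
theorem map_eq_map_of_moments_eq {X : Ω → ℝ} (hX : Measurable X) {μ₁ μ₂ : Measure Ω}
    [IsFiniteMeasure μ₁] [IsFiniteMeasure μ₂] (h₁ : 0 ∈ interior (integrableExpSet X μ₁))
    (h₂ : 0 ∈ interior (integrableExpSet X μ₂))
    (hmom : ∀ n : ℕ, ∫ ω, X ω ^ n ∂μ₁ = ∫ ω, X ω ^ n ∂μ₂) : μ₁.map X = μ₂.map X := by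
  set S : Set ℝ := interior (integrableExpSet X μ₁) ∩ interior (integrableExpSet X μ₂) with hS
  have hSconv : Convex ℝ S := convex_integrableExpSet.interior.inter convex_integrableExpSet.interior
  have hd : ∀ n, iteratedDeriv n (complexMGF X μ₁) 0 = iteratedDeriv n (complexMGF X μ₂) 0 := by
    intro n
    rw [iteratedDeriv_complexMGF (by simpa using h₁), iteratedDeriv_complexMGF (by simpa using h₂)]
    simp only [zero_mul, Complex.exp_zero, mul_one]
    have := congrArg (fun r : ℝ => (r : ℂ)) (hmom n)
    simpa only [← integral_complex_ofReal, Complex.ofReal_pow] using this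
  have hA₁ := (analyticAt_complexMGF (X := X) (μ := μ₁) (z := 0) (by simpa using h₁)).hasFPowerSeriesAt
  have hA₂ := (analyticAt_complexMGF (X := X) (μ := μ₂) (z := 0) (by simpa using h₂)).hasFPowerSeriesAt
  simp only [hd] at hA₁
  have hev : complexMGF X μ₁ =ᶠ[𝓝 0] complexMGF X μ₂ := by
    have h0 := hA₁.sub hA₂
    rw [sub_self] at h0
    filter_upwards [h0.eventually_eq_zero] with z hz
    exact sub_eq_zero.mp hz
  have hEq : Set.EqOn (complexMGF X μ₁) (complexMGF X μ₂) {z | z.re ∈ S} :=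
    AnalyticOnNhd.eqOn_of_preconnected_of_eventuallyEq
      (analyticOnNhd_complexMGF.mono fun z hz => hz.1)
      (analyticOnNhd_complexMGF.mono fun z hz => hz.2)
      (hSconv.linear_preimage Complex.reLm).isPreconnected (z₀ := 0)
      (show (0 : ℂ).re ∈ S from ⟨by simpa using h₁, by simpa using h₂⟩) hev
  refine Measure.ext_of_charFun (funext fun ξ => ?_)
  rw [← complexMGF_mul_I hX.aemeasurable, ← complexMGF_mul_I hX.aemeasurable]
  exact hEq (show ((ξ : ℂ) * Complex.I).re ∈ S from ⟨by simpa using h₁, by simpa using h₂⟩)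

lemma zero_mem_interior_integrableExpSet_withDensity {P : Measure Ω} {X Z : Ω → ℝ}
    (hX : Measurable X) (hexp : 0 ∈ interior (integrableExpSet X P)) (hZm : Measurable Z)
    (hZ : MemLp Z 2 P) :
    0 ∈ interior (integrableExpSet X (P.withDensity fun ω => ENNReal.ofReal (Z ω))) := by
  rw [mem_interior_iff_mem_nhds, Metric.mem_nhds_iff] at hexp ⊢
  obtain ⟨c, hc, hball⟩ := hexp
  refine ⟨c / 2, by positivity, fun r hr => ?_⟩
  have h2r : 2 * r ∈ integrableExpSet X P := by
    apply hball
    rw [Metric.mem_ball, Real.dist_eq, sub_zero] at hr ⊢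
    rw [abs_mul, abs_two]; linarith
  have hE : MemLp (fun ω => Real.exp (r * X ω)) 2 P := by
    rw [memLp_two_iff_integrable_sq (by fun_prop)]
    refine Integrable.congr h2r (ae_of_all _ fun ω => ?_)
    simp only
    rw [← Real.exp_nat_mul]; ring_nf
  change Integrable _ _
  rw [integrable_withDensity_iff_integrable_smul' (by fun_prop)
    (ae_of_all _ fun _ => ENNReal.ofReal_lt_top)]
  have hprod : Integrable (fun ω => Z ω * Real.exp (r * X ω)) P := hZ.integrable_mul hE
  refine hprod.mono (by fun_prop) (ae_of_all _ fun ω => ?_)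
  rw [smul_eq_mul, norm_mul, norm_mul, ENNReal.toReal_ofReal']
  gcongr
  rw [Real.norm_eq_abs, Real.norm_eq_abs, abs_of_nonneg (le_max_right _ _)]
  exact max_le (le_abs_self _) (abs_nonneg _)

/-- A square integrable `Z` orthogonal to all powers of a random variable `X` with exponential
moments is orthogonal to `σ(X)`. This replaces the density of polynomials in `L²` of the law of
`X`. -/
theorem setIntegral_preimage_eq_zero {P : Measure Ω} [IsFiniteMeasure P] {X Z : Ω → ℝ}
    (hX : Measurable X) (hexp : 0 ∈ interior (integrableExpSet X P)) (hZm : Measurable Z)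
    (hZ : MemLp Z 2 P) (hmom : ∀ n : ℕ, ∫ ω, Z ω * X ω ^ n ∂P = 0) {B : Set ℝ}
    (hB : MeasurableSet B) : ∫ ω in X ⁻¹' B, Z ω ∂P = 0 := by
  have hZ1 : Integrable Z P := hZ.integrable one_le_two
  have hXn : ∀ n : ℕ, MemLp (fun ω => X ω ^ n) 2 P := by
    intro n
    rw [memLp_two_iff_integrable_sq (by fun_prop)]
    simpa only [← pow_mul] using integrable_pow_of_mem_interior_integrableExpSet hexp (n * 2)
  have hden : ∀ W : Ω → ℝ, Measurable W → Integrable W P →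
      IsFiniteMeasure (P.withDensity fun ω => ENNReal.ofReal (W ω)) :=
    fun W _ hW => isFiniteMeasure_withDensity_ofReal hW.2
  have hf₁ := hden Z hZm hZ1
  have hf₂ := hden (fun ω => -Z ω) hZm.neg hZ1.neg
  have hmap := map_eq_map_of_moments_eq hX
    (zero_mem_interior_integrableExpSet_withDensity hX hexp hZm hZ)
    (zero_mem_interior_integrableExpSet_withDensity hX hexp hZm.neg hZ.neg)
    (fun n => by
      rw [integral_withDensity_eq_integral_toReal_smul (by fun_prop)
          (ae_of_all _ fun _ => ENNReal.ofReal_lt_top),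
        integral_withDensity_eq_integral_toReal_smul (by fun_prop)
          (ae_of_all _ fun _ => ENNReal.ofReal_lt_top), ← sub_eq_zero, ← integral_sub]
      · rw [← hmom n]
        refine integral_congr_ae (ae_of_all _ fun ω => ?_)
        simp only [smul_eq_mul, ENNReal.toReal_ofReal', Pi.neg_apply]
        rw [← sub_mul, max_zero_sub_eq_self]
      · simp only [smul_eq_mul, ENNReal.toReal_ofReal']
        exact hZ.pos_part.integrable_mul (hXn n)
      · simp only [smul_eq_mul, ENNReal.toReal_ofReal']
        exact hZ.neg_part.integrable_mul (hXn n))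
  have hBm := congrArg (fun ν : Measure ℝ => (ν B).toReal) hmap
  simp only [Measure.map_apply hX hB, withDensity_apply _ (hX hB), Pi.neg_apply] at hBm
  rw [integral_eq_lintegral_pos_part_sub_lintegral_neg_part hZ1.integrableOn, hBm, sub_self]

end Determinacy

/-! ### Exponential moments of `μ_{0,0,t}` -/

section ExpMoments

lemma integrable_eval_of_integrable_pow {Ω : Type*} {mΩ : MeasurableSpace Ω} {μ : Measure Ω}
    {X : Ω → ℝ} (h : ∀ n : ℕ, Integrable (fun ω => X ω ^ n) μ) (p : Polynomial ℝ) :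
    Integrable (fun ω => p.eval (X ω)) μ := by
  simp only [Polynomial.eval_eq_sum_range]
  exact integrable_finsetSum _ fun i _ => (h i).const_mul _

/-- A measure all of whose moments satisfy `|∫ yⁿ| ≤ Cⁿ n!` has exponential moments. -/
theorem zero_mem_interior_integrableExpSet_of_moments_le {ν : Measure ℝ}
    (hint : ∀ n : ℕ, Integrable (fun y : ℝ => y ^ n) ν) {C : ℝ} (hC : 0 < C)
    (hmom : ∀ n : ℕ, |∫ y, y ^ n ∂ν| ≤ C ^ n * n.factorial) :
    0 ∈ interior (integrableExpSet id ν) := by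
  rw [mem_interior_iff_mem_nhds, Metric.mem_nhds_iff]
  refine ⟨1 / (2 * C), by positivity, fun r hr => ?_⟩
  rw [Metric.mem_ball, Real.dist_eq, sub_zero, lt_div_iff₀ (by positivity)] at hr
  have hrC : |r * C| ≤ 1 / 2 := by rw [abs_mul, abs_of_pos hC]; linarith
  have hterm : ∀ k : ℕ, Integrable (fun y : ℝ => (r * y) ^ (2 * k) / ((2 * k).factorial : ℝ)) ν := by
    intro k
    simp only [mul_pow]
    exact ((hint (2 * k)).const_mul _).div_const _
  have hnn : ∀ (k : ℕ) (y : ℝ), 0 ≤ (r * y) ^ (2 * k) / ((2 * k).factorial : ℝ) := fun k y =>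
    div_nonneg ((even_two_mul k).pow_nonneg _) (by positivity)
  have hbound : ∀ k : ℕ, ∫ y, (r * y) ^ (2 * k) / ((2 * k).factorial : ℝ) ∂ν ≤ (1 / 4) ^ k := by
    intro k
    have h1 := (le_abs_self _).trans (hmom (2 * k))
    rw [integral_div, div_le_iff₀ (by positivity)]
    simp only [mul_pow]
    rw [integral_const_mul]
    calc r ^ (2 * k) * ∫ y, y ^ (2 * k) ∂ν
        ≤ r ^ (2 * k) * (C ^ (2 * k) * (2 * k).factorial) :=
          mul_le_mul_of_nonneg_left h1 ((even_two_mul k).pow_nonneg _)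
      _ = (r * C) ^ (2 * k) * (2 * k).factorial := by rw [mul_pow]; ring
      _ ≤ (1 / 4) ^ k * (2 * k).factorial := by
          gcongr
          rw [pow_mul]
          refine pow_le_pow_left₀ (sq_nonneg _) ?_ _
          rw [← sq_abs]; nlinarith [abs_nonneg (r * C)]
  have hcosh : Integrable (fun y : ℝ => Real.cosh (r * y)) ν := by
    refine ⟨by fun_prop, ?_⟩
    rw [hasFiniteIntegral_iff_ofReal (ae_of_all _ fun y => (Real.cosh_pos _).le)]
    have hser : ∀ y : ℝ, ENNReal.ofReal (Real.cosh (r * y)) =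
        ∑' k : ℕ, ENNReal.ofReal ((r * y) ^ (2 * k) / ((2 * k).factorial : ℝ)) := fun y => by
      rw [← ENNReal.ofReal_tsum_of_nonneg (fun k => hnn k y) (Real.hasSum_cosh _).summable,
        (Real.hasSum_cosh _).tsum_eq]
    simp only [hser]
    rw [lintegral_tsum fun k => by fun_prop]
    have hgeo : Summable fun k : ℕ => (1 / 4 : ℝ) ^ k :=
      summable_geometric_of_lt_one (by norm_num) (by norm_num)
    refine lt_of_le_of_lt (ENNReal.tsum_le_tsum fun k => ?_) hgeo.tsum_ofReal_lt_top
    rw [← ofReal_integral_eq_lintegral_ofReal (hterm k) (ae_of_all _ (hnn k))]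
    exact ENNReal.ofReal_le_ofReal (hbound k)
  refine (hcosh.const_mul 2).mono (by fun_prop) (ae_of_all _ fun y => ?_)
  rw [Real.norm_eq_abs, Real.norm_eq_abs, Real.abs_exp, id, abs_of_pos (by positivity), Real.cosh_eq]
  linarith [Real.exp_pos (-(r * y))]

variable {q θ τ : ℝ}

lemma Orthogonalizes.integral_eval_eq_zero {x s t : ℝ} {ν : Measure ℝ}
    (h : Orthogonalizes q θ τ x s t ν) {n : ℕ} (hn : n ≠ 0) :
    ∫ y, (Q q θ τ x s t n).eval y ∂ν = 0 := by
  simpa using h.orthogonal n 0 hn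

/-- The quantities `∫ yⁿ Q_j dν` satisfy the recurrence given by the Jacobi matrix, whose entries
grow at most linearly on and quadratically below the diagonal. -/
lemma Orthogonalizes.abs_integral_pow_mul_eval_le (hq : |q| ≤ 1) (hτ : 0 ≤ τ) {t : ℝ} (ht : 0 ≤ t)
    {ν : Measure ℝ} (h : Orthogonalizes q θ τ 0 0 t ν) (n j : ℕ) :
    (n < j → ∫ y, y ^ n * (Q q θ τ 0 0 t j).eval y ∂ν = 0) ∧
      |∫ y, y ^ n * (Q q θ τ 0 0 t j).eval y ∂ν| ≤
        (1 + |θ| + (t + τ)) ^ n * n.factorial * j.factorial := by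
  have := h.isProbabilityMeasure
  set C := 1 + |θ| + (t + τ) with hC
  have hC0 : 0 ≤ C := by positivity
  set d : ℕ → ℕ → ℝ := fun n j => ∫ y, y ^ n * (Q q θ τ 0 0 t j).eval y ∂ν with hd
  have hint : ∀ n j, Integrable (fun y : ℝ => y ^ n * (Q q θ τ 0 0 t j).eval y) ν := by
    intro n j
    refine (integrable_eval_of_integrable_pow (X := fun y => y) h.integrable_pow
      (Polynomial.X ^ n * Q q θ τ 0 0 t j)).congr (ae_of_all _ fun y => ?_)
    simp only [Polynomial.eval_mul, Polynomial.eval_pow, Polynomial.eval_X]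
  have hrec : ∀ n j, d (n + 1) j = d n (j + 1) + θ * qInt q j * d n j
      + (t + τ * qInt q (j - 1)) * qInt q j * d n (j - 1) := by
    intro n j
    simp only [hd]
    rw [← integral_const_mul, ← integral_const_mul,
      ← integral_add (hint n (j + 1)) ((hint n j).const_mul _), ← integral_add]
    rotate_left
    · exact (hint n (j + 1)).add ((hint n j).const_mul _)
    · exact (hint n (j - 1)).const_mul _
    congr 1
    funext y
    have := mul_eval_Q q θ τ 0 0 t y j
    linear_combination y ^ n * this
  change (n < j → d n j = 0) ∧ |d n j| ≤ C ^ n * n.factorial * j.factorial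
  induction n generalizing j with
  | zero =>
    have h0 : ∀ j, j ≠ 0 → d 0 j = 0 := fun j hj => by simpa [hd] using h.integral_eval_eq_zero hj
    refine ⟨fun hj => h0 j (by omega), ?_⟩
    rcases Nat.eq_zero_or_pos j with rfl | hj
    · simp [hd]
    · rw [h0 j (by omega)]; simp
  | succ n ih =>
    have hzero : n + 1 < j → d (n + 1) j = 0 := fun hj => by
      rw [hrec, (ih (j + 1)).1 (by omega), (ih j).1 (by omega), (ih (j - 1)).1 (by omega)]; ring
    refine ⟨hzero, ?_⟩
    rcases lt_or_ge (n + 1) j with hj | hj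
    · rw [hzero hj]; simp; positivity
    -- The integrals vanish above the diagonal, so only indices at most `n + 1` contribute, and each
    -- of the three terms of the recurrence is at most its constant times `K * (n + 1)`.
    set K : ℝ := C ^ n * n.factorial * j.factorial with hK
    have hK0 : 0 ≤ K := by positivity
    have hjn : (j : ℝ) ≤ n + 1 := by exact_mod_cast hj
    have b1 : |d n (j + 1)| ≤ K * (n + 1) := by
      rcases lt_or_ge n (j + 1) with h1 | h1
      · rw [(ih (j + 1)).1 h1]; simp; positivity
      · refine (ih (j + 1)).2.trans ?_
        rw [Nat.factorial_succ, Nat.cast_mul]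
        have : ((j + 1 : ℕ) : ℝ) ≤ n + 1 := by exact_mod_cast h1.trans n.le_succ
        calc C ^ n * n.factorial * (((j + 1 : ℕ) : ℝ) * j.factorial) = K * ((j + 1 : ℕ) : ℝ) := by
              rw [hK]; ring
          _ ≤ _ := by gcongr
    have b2 : |θ * qInt q j * d n j| ≤ |θ| * (K * (n + 1)) := by
      rw [abs_mul, abs_mul, mul_assoc]
      refine mul_le_mul_of_nonneg_left ?_ (abs_nonneg _)
      rw [mul_comm]
      exact mul_le_mul (ih j).2 ((abs_qInt_le hq j).trans hjn) (abs_nonneg _) hK0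
    have b3 : |(t + τ * qInt q (j - 1)) * qInt q j * d n (j - 1)| ≤ (t + τ) * (K * (n + 1)) := by
      rcases j with _ | j
      · simp; positivity
      · rw [Nat.add_sub_cancel, abs_mul, abs_mul]
        have hj1 : (1 : ℝ) ≤ (j + 1 : ℕ) := by exact_mod_cast Nat.le_add_left 1 j
        have c1 : |t + τ * qInt q j| ≤ (t + τ) * (j + 1 : ℕ) := by
          refine (abs_add_le _ _).trans ?_
          rw [abs_mul, abs_of_nonneg ht, abs_of_nonneg hτ]
          have := abs_qInt_le hq j
          push_cast at hj1 ⊢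
          nlinarith
        calc |t + τ * qInt q j| * |qInt q (j + 1)| * |d n j|
            ≤ ((t + τ) * (j + 1 : ℕ)) * ((j + 1 : ℕ) : ℝ) * (C ^ n * n.factorial * j.factorial) :=
              mul_le_mul (mul_le_mul c1 (abs_qInt_le hq _) (abs_nonneg _) (by positivity))
                (ih j).2 (abs_nonneg _) (by positivity)
          _ = (t + τ) * (K * (j + 1 : ℕ)) := by
              rw [hK, Nat.factorial_succ, Nat.cast_mul]; ring
          _ ≤ _ := by gcongr
    rw [hrec]
    calc _ ≤ |d n (j + 1)| + |θ * qInt q j * d n j|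
          + |(t + τ * qInt q (j - 1)) * qInt q j * d n (j - 1)| := abs_add_three _ _ _
      _ ≤ K * (n + 1) + |θ| * (K * (n + 1)) + (t + τ) * (K * (n + 1)) := by gcongr
      _ = C ^ (n + 1) * (n + 1).factorial * j.factorial := by
          rw [hK, Nat.factorial_succ, Nat.cast_mul, hC]; push_cast; ring

theorem Orthogonalizes.zero_mem_interior_integrableExpSet (hq : |q| ≤ 1) (hτ : 0 ≤ τ) {t : ℝ}
    (ht : 0 ≤ t) {ν : Measure ℝ} (h : Orthogonalizes q θ τ 0 0 t ν) :
    0 ∈ interior (integrableExpSet id ν) := by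
  refine zero_mem_interior_integrableExpSet_of_moments_le h.integrable_pow
    (C := 1 + |θ| + (t + τ)) (by positivity) fun n => ?_
  simpa using (h.abs_integral_pow_mul_eval_le hq hτ ht n 0).2

end ExpMoments

/-! ### Random variables with moments of all orders -/

section FiniteMoments

variable {Ω : Type*} {mΩ : MeasurableSpace Ω} {P : Measure Ω} {f g : Ω → ℝ}

/-- The random variable `f` belongs to `Lᵖ` for every finite `p`. -/
def FiniteMoments (P : Measure Ω) (f : Ω → ℝ) : Prop := ∀ p : ENNReal, p ≠ ⊤ → MemLp f p P

lemma FiniteMoments.integrable (hf : FiniteMoments P f) : Integrable f P :=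
  memLp_one_iff_integrable.mp (hf 1 (by simp))

lemma FiniteMoments.memLp_two (hf : FiniteMoments P f) : MemLp f 2 P := hf 2 (by simp)

lemma FiniteMoments.mul (hf : FiniteMoments P f) (hg : FiniteMoments P g) :
    FiniteMoments P fun ω => f ω * g ω := by
  intro p hp
  have h2p : 2 * p ≠ ⊤ := ENNReal.mul_ne_top (by simp) hp
  have : ENNReal.HolderTriple (2 * p) (2 * p) p := by
    refine ⟨?_⟩
    rw [ENNReal.mul_inv (Or.inl two_ne_zero) (Or.inl (by simp)), ← add_mul,
      ENNReal.inv_two_add_inv_two, one_mul]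
  exact (hg _ h2p).mul (hf _ h2p)

lemma FiniteMoments.sub (hf : FiniteMoments P f) (hg : FiniteMoments P g) :
    FiniteMoments P fun ω => f ω - g ω := fun p hp => (hf p hp).sub (hg p hp)

lemma FiniteMoments.add (hf : FiniteMoments P f) (hg : FiniteMoments P g) :
    FiniteMoments P fun ω => f ω + g ω := fun p hp => (hf p hp).add (hg p hp)

lemma finiteMoments_const [IsFiniteMeasure P] (c : ℝ) : FiniteMoments P fun _ => c :=
  fun _ _ => memLp_const c

lemma FiniteMoments.const_mul (hf : FiniteMoments P f) (c : ℝ) :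
    FiniteMoments P fun ω => c * f ω := fun p hp => (hf p hp).const_mul c

lemma FiniteMoments.pow [IsFiniteMeasure P] (hf : FiniteMoments P f) (n : ℕ) :
    FiniteMoments P fun ω => f ω ^ n := by
  induction n with
  | zero => simpa using finiteMoments_const 1
  | succ n ih => simpa only [pow_succ] using ih.mul hf

lemma FiniteMoments.eval [IsFiniteMeasure P] (hf : FiniteMoments P f) (p : Polynomial ℝ) :
    FiniteMoments P fun ω => p.eval (f ω) := by
  induction p using Polynomial.induction_on' with
  | add p r hp hr => simpa only [Polynomial.eval_add] using hp.add hr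
  | monomial n a => simpa only [Polynomial.eval_monomial] using (hf.pow n).const_mul a

lemma FiniteMoments.indicator (hf : FiniteMoments P f) {A : Set Ω} (hA : MeasurableSet A) :
    FiniteMoments P (A.indicator f) := fun p hp => (hf p hp).indicator hA

end FiniteMoments

/-! ### The σ-fields of the process -/

section SigmaField

variable {Ω : Type*} {X : ℝ≥0 → Ω → ℝ}

lemma sigmaField_le [MeasurableSpace Ω] (hX : ∀ t, Measurable (X t)) (T : Set ℝ≥0) :
    sigmaField X T ≤ ‹MeasurableSpace Ω› :=
  iSup₂_le fun r _ => (hX r).comap_le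

lemma measurable_sigmaField {T : Set ℝ≥0} {r : ℝ≥0} (hr : r ∈ T) :
    Measurable[sigmaField X T] (X r) :=
  Measurable.of_comap_le (le_iSup₂_of_le r hr le_rfl)

lemma past_mono {s t : ℝ≥0} (h : s ≤ t) : past X s ≤ past X t :=
  biSup_mono fun _ hr => le_trans hr h

end SigmaField

/-! ### Martingale polynomials of the process -/

section Martingale

variable {q θ τ : ℝ} {Ω : Type*} [MeasurableSpace Ω] {P : Measure Ω} {X : ℝ≥0 → Ω → ℝ}

/-- The consequences of the Markov property from which the conditional moments are computed: the
process starts at `0`, has exponential moments, and `Q_n(X_t | 0, 0, t)` is a martingale for each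
`n`. -/
structure HasMartingalePolynomials (q θ τ : ℝ) (P : Measure Ω) (X : ℝ≥0 → Ω → ℝ) : Prop where
  measurable : ∀ t, Measurable (X t)
  zero : ∀ᵐ ω ∂P, X 0 ω = 0
  exp_moments : ∀ t, 0 ∈ interior (integrableExpSet (X t) P)
  martingale : ∀ s t : ℝ≥0, s ≤ t → ∀ n : ℕ,
    P[fun ω => (Q q θ τ 0 0 t n).eval (X t ω) | past X s] =ᵐ[P]
      fun ω => (Q q θ τ 0 0 s n).eval (X s ω)

lemma orthogonalizes_transitionMeasure {x s t : ℝ} (h : transitionMeasure q θ τ x s t ≠ 0) :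
    Orthogonalizes q θ τ x s t (transitionMeasure q θ τ x s t) := by
  unfold transitionMeasure at h ⊢
  split_ifs with hex
  · exact hex.choose_spec
  · simp [hex] at h

/-- The average of `Q_n(· | x₀, s₀, t)` over a step from `(s, x)` to time `t`: all terms of the
convolution identity but the one with `Q_0(· | x, s, t)` vanish by orthogonality to `1`. -/
lemma Orthogonalizes.integral_eval_Q {x s t : ℝ} {ν : Measure ℝ}
    (h : Orthogonalizes q θ τ x s t ν) (x₀ s₀ : ℝ) (n : ℕ) :
    ∫ y, (Q q θ τ x₀ s₀ t n).eval y ∂ν = (Q q θ τ x₀ s₀ s n).eval x := by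
  have := h.isProbabilityMeasure
  have hint : ∀ k, Integrable (fun y => (Q q θ τ x s t k).eval y) ν := fun k =>
    integrable_eval_of_integrable_pow (X := fun y => y) h.integrable_pow _
  simp_rw [eval_Q_eq_sum q θ τ x₀ s₀ x s t _ n]
  rw [integral_finsetSum _ fun p _ => ((hint p.2).const_mul _).const_mul _]
  simp_rw [integral_const_mul]
  rw [Finset.sum_eq_single (n, 0)]
  · simp
  · rintro ⟨j, k⟩ hp hne
    rw [mem_antidiagonal] at hp
    have hk : k ≠ 0 := by
      rintro rfl
      exact hne (by simpa using hp)
    simp [h.integral_eval_eq_zero hk]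
  · intro hn
    exact absurd (by simp) hn

/-- A real random variable has a regular conditional law given any sub-σ-field. -/
lemma exists_regular_conditional_law {Ω : Type*} {m mΩ : MeasurableSpace Ω} (P : Measure Ω)
    [IsFiniteMeasure P] (hm : m ≤ mΩ) {Y : Ω → ℝ} (hY : Measurable Y) :
    ∃ κ : Ω → Measure ℝ, (∀ ω, IsProbabilityMeasure (κ ω)) ∧
      (∀ A, MeasurableSet A →
        (fun ω => (κ ω).real A) =ᵐ[P] P[(Y ⁻¹' A).indicator (fun _ => (1 : ℝ)) | m]) ∧
      ∀ f : ℝ → ℝ, StronglyMeasurable f → Integrable (fun ω => f (Y ω)) P →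
        P[fun ω => f (Y ω) | m] =ᵐ[P] fun ω => ∫ y, f y ∂(κ ω) := by
  have hid : @Measurable Ω Ω mΩ m fun ω => ω := measurable_id'' hm
  have hcomap : MeasurableSpace.comap (fun ω : Ω => ω) m = m := MeasurableSpace.comap_id
  refine ⟨fun ω => @condDistrib Ω Ω ℝ _ _ _ mΩ m Y (fun ω => ω) P _ ω, fun ω => ?_,
    fun A hA => ?_, fun f hf hint => ?_⟩
  · infer_instance
  · simpa only [hcomap] using condDistrib_ae_eq_condExp (μ := P) hid hY hA
  · simpa only [hcomap] using condExp_ae_eq_integral_condDistrib hid hY.aemeasurable hf hint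

variable [IsProbabilityMeasure P]
  (hX : IsMarkovFromZero P X (fun s t x => transitionMeasure q θ τ x (s : ℝ) (t : ℝ)))
include hX

/-- Where the transition measure is not the orthogonalizing measure it is `0`, which has the wrong
total mass. -/
lemma IsMarkovFromZero.ae_orthogonalizes {s t : ℝ≥0} (hst : s < t) :
    ∀ᵐ ω ∂P, Orthogonalizes q θ τ (X s ω) s t (transitionMeasure q θ τ (X s ω) s t) := by
  have h := hX.transition s t hst Set.univ MeasurableSet.univ
  simp only [Set.preimage_univ, Set.indicator_univ] at h
  rw [condExp_const (sigmaField_le hX.measurable _)] at h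
  filter_upwards [h] with ω hω
  refine orthogonalizes_transitionMeasure fun h0 => ?_
  rw [h0] at hω
  simp at hω

/-- The transition probabilities, given on sets, integrate functions: they agree almost surely with a
regular conditional law. -/
lemma IsMarkovFromZero.condExp_ae_eq {s t : ℝ≥0} (hst : s < t) {f : ℝ → ℝ}
    (hf : StronglyMeasurable f) (hint : Integrable (fun ω => f (X t ω)) P) :
    P[fun ω => f (X t ω) | past X s] =ᵐ[P]
      fun ω => ∫ y, f y ∂(transitionMeasure q θ τ (X s ω) s t) := by
  obtain ⟨κ, hκ, hκA, hκf⟩ := exists_regular_conditional_law P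
    (sigmaField_le hX.measurable (Set.Iic s)) (hX.measurable t)
  have hQ : ∀ᵐ ω ∂P, ∀ r : ℚ,
      (transitionMeasure q θ τ (X s ω) s t).real (Set.Iic (r : ℝ)) = (κ ω).real (Set.Iic (r : ℝ)) :=
    ae_all_iff.mpr fun r =>
      (hX.transition s t hst _ measurableSet_Iic).symm.trans (hκA _ measurableSet_Iic).symm
  filter_upwards [hκf f hf hint, hX.ae_orthogonalizes hst, hQ] with ω h1 horth h2
  have := horth.isProbabilityMeasure
  have := hκ ω
  suffices h : transitionMeasure q θ τ (X s ω) s t = κ ω by rw [h1, h]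
  refine ext_of_generate_finite _ Real.borel_eq_generateFrom_Iic_rat Real.isPiSystem_Iic_rat ?_
    (by simp)
  intro S hS
  simp only [Set.mem_iUnion, Set.mem_singleton_iff] at hS
  obtain ⟨r, rfl⟩ := hS
  exact (measureReal_eq_measureReal_iff).mp (h2 r)

lemma IsMarkovFromZero.orthogonalizes_map {t : ℝ≥0} (ht : 0 < t) :
    Orthogonalizes q θ τ 0 0 t (P.map (X t)) := by
  have hae := hX.ae_orthogonalizes ht
  have horth : Orthogonalizes q θ τ 0 0 t (transitionMeasure q θ τ 0 0 t) := by
    obtain ⟨ω, h1, h2⟩ := (hae.and hX.zero).exists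
    simpa [h2] using h1
  have := horth.isProbabilityMeasure
  have := Measure.isProbabilityMeasure_map (μ := P) (hX.measurable t).aemeasurable
  suffices h : P.map (X t) = transitionMeasure q θ τ 0 0 t by rwa [h]
  ext A hA
  rw [← measureReal_eq_measureReal_iff, map_measureReal_apply (hX.measurable t) hA]
  have h1 := hX.transition 0 t ht A hA
  have h2 := integral_congr_ae h1
  rw [integral_condExp (sigmaField_le hX.measurable _),
    integral_indicator_const _ (hX.measurable t hA), smul_eq_mul, mul_one] at h2
  rw [h2, integral_congr_ae (g := fun _ => (transitionMeasure q θ τ 0 0 t).real A)]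
  · simp
  · filter_upwards [hX.zero] with ω hω
    simp [hω]

lemma IsMarkovFromZero.hasMartingalePolynomials (hq : |q| ≤ 1) (hτ : 0 ≤ τ) :
    HasMartingalePolynomials q θ τ P X := by
  have hexp : ∀ t, 0 ∈ interior (integrableExpSet (X t) P) := by
    intro t
    rcases eq_or_lt_of_le (show 0 ≤ t from zero_le) with rfl | ht
    · have huniv : integrableExpSet (X 0) P = Set.univ := by
        refine Set.eq_univ_of_forall fun r => ?_
        refine (integrable_const (1 : ℝ)).congr ?_
        filter_upwards [hX.zero] with ω hω
        simp [hω]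
      simp [huniv]
    · have h := (hX.orthogonalizes_map ht).zero_mem_interior_integrableExpSet hq hτ t.2
      have hset : integrableExpSet id (P.map (X t)) = integrableExpSet (X t) P := by
        ext r
        exact integrable_map_measure (by fun_prop) (hX.measurable t).aemeasurable
      rwa [hset] at h
  refine ⟨hX.measurable, hX.zero, hexp, fun s t hst n => ?_⟩
  have hint : Integrable (fun ω => (Q q θ τ 0 0 t n).eval (X t ω)) P :=
    integrable_eval_of_integrable_pow
      (fun k => integrable_pow_of_mem_interior_integrableExpSet (hexp t) k) _
  rcases eq_or_lt_of_le hst with rfl | hst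
  · rw [condExp_of_stronglyMeasurable (sigmaField_le hX.measurable _) _ hint]
    exact ((Q q θ τ 0 0 s n).continuous.measurable.comp
      (measurable_sigmaField (Set.mem_Iic.mpr le_rfl))).stronglyMeasurable
  · refine (hX.condExp_ae_eq hst (f := fun y => (Q q θ τ 0 0 t n).eval y)
      (Q q θ τ 0 0 t n).continuous.stronglyMeasurable hint).trans ?_
    filter_upwards [hX.ae_orthogonalizes hst] with ω hω
    exact hω.integral_eval_Q 0 0 n

end Martingale

/-! ### Mixed moments and the Jacobi operator -/

/-- The Jacobi operator of the polynomials `Q_n(· | 0, 0, t)`: it maps the sequence of the values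
`∫ W Q_n(X_t)` to the sequence of the values `∫ W X_t Q_n(X_t)`. It is affine in `t`. -/
def jacobi (q θ τ t : ℝ) (m : ℕ → ℝ) (n : ℕ) : ℝ :=
  m (n + 1) + θ * qInt q n * m n + (t + τ * qInt q (n - 1)) * qInt q n * m (n - 1)

section Moments

variable {q θ τ : ℝ} {Ω : Type*} [MeasurableSpace Ω] {P : Measure Ω} [IsProbabilityMeasure P]
  {X : ℝ≥0 → Ω → ℝ} (h : HasMartingalePolynomials q θ τ P X)
include h

omit [IsProbabilityMeasure P] in
lemma HasMartingalePolynomials.finiteMoments (t : ℝ≥0) : FiniteMoments P (X t) := by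
  intro p hp
  lift p to ℝ≥0 using hp
  exact memLp_of_mem_interior_integrableExpSet (h.exp_moments t) p

omit [IsProbabilityMeasure P] in
lemma HasMartingalePolynomials.past_le (s : ℝ≥0) : past X s ≤ ‹MeasurableSpace Ω› :=
  sigmaField_le h.measurable _

omit [MeasurableSpace Ω] [IsProbabilityMeasure P] h in
lemma measurable_past {r s : ℝ≥0} (hrs : r ≤ s) : Measurable[past X s] (X r) :=
  measurable_sigmaField (Set.mem_Iic.mpr hrs)

lemma HasMartingalePolynomials.integral_mul_eval {s t : ℝ≥0} (hst : s ≤ t) {W : Ω → ℝ}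
    (hW : Measurable[past X s] W) (hWf : FiniteMoments P W) (n : ℕ) :
    ∫ ω, W ω * (Q q θ τ 0 0 t n).eval (X t ω) ∂P =
      ∫ ω, W ω * (Q q θ τ 0 0 s n).eval (X s ω) ∂P := by
  have hM := (h.finiteMoments t).eval (Q q θ τ 0 0 t n)
  rw [← integral_condExp (h.past_le s)]
  refine integral_congr_ae ?_
  have h1 := condExp_mul_of_stronglyMeasurable_left (m := past X s) (μ := P) (f := W)
    (g := fun ω => (Q q θ τ 0 0 t n).eval (X t ω)) hW.stronglyMeasurable (hWf.mul hM).integrable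
    hM.integrable
  refine h1.trans ?_
  filter_upwards [h.martingale s t hst n] with ω hω
  rw [Pi.mul_apply, hω]

lemma HasMartingalePolynomials.integral_mul_mul_eval (t : ℝ≥0) {W : Ω → ℝ}
    (hWf : FiniteMoments P W) (n : ℕ) :
    ∫ ω, (W ω * X t ω) * (Q q θ τ 0 0 t n).eval (X t ω) ∂P =
      jacobi q θ τ t (fun k => ∫ ω, W ω * (Q q θ τ 0 0 t k).eval (X t ω) ∂P) n := by
  have hint : ∀ k, Integrable (fun ω => W ω * (Q q θ τ 0 0 t k).eval (X t ω)) P := fun k =>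
    (hWf.mul ((h.finiteMoments t).eval _)).integrable
  unfold jacobi
  rw [← integral_const_mul, ← integral_const_mul,
    ← integral_add (hint (n + 1)) ((hint n).const_mul _), ← integral_add]
  rotate_left
  · exact (hint (n + 1)).add ((hint n).const_mul _)
  · exact (hint (n - 1)).const_mul _
  congr 1
  funext ω
  have := mul_eval_Q q θ τ 0 0 t (X t ω) n
  linear_combination W ω * this

/-- First moments against the past and the future. -/
lemma HasMartingalePolynomials.integral_mul_X_mul_eval {s r u : ℝ≥0} (hsr : s ≤ r) (hru : r ≤ u)
    {W : Ω → ℝ} (hW : Measurable[past X s] W) (hWf : FiniteMoments P W) (n : ℕ) :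
    ∫ ω, (W ω * X r ω) * (Q q θ τ 0 0 u n).eval (X u ω) ∂P =
      jacobi q θ τ r (fun k => ∫ ω, W ω * (Q q θ τ 0 0 s k).eval (X s ω) ∂P) n := by
  rw [h.integral_mul_eval (W := fun ω => W ω * X r ω) hru
    ((hW.mono (past_mono hsr) le_rfl).mul (measurable_past le_rfl))
    (hWf.mul (h.finiteMoments r)), h.integral_mul_mul_eval r hWf]
  simp_rw [h.integral_mul_eval hsr hW hWf]

/-- Second moments against the past and the future. -/
lemma HasMartingalePolynomials.integral_mul_X_mul_X_mul_eval {s r r' u : ℝ≥0} (hsr : s ≤ r)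
    (hrr' : r ≤ r') (hr'u : r' ≤ u) {W : Ω → ℝ} (hW : Measurable[past X s] W)
    (hWf : FiniteMoments P W) (n : ℕ) :
    ∫ ω, (W ω * X r ω * X r' ω) * (Q q θ τ 0 0 u n).eval (X u ω) ∂P =
      jacobi q θ τ r' (jacobi q θ τ r
        (fun k => ∫ ω, W ω * (Q q θ τ 0 0 s k).eval (X s ω) ∂P)) n := by
  rw [h.integral_mul_X_mul_eval (W := fun ω => W ω * X r ω) hrr' hr'u
    ((hW.mono (past_mono hsr) le_rfl).mul (measurable_past le_rfl))
    (hWf.mul (h.finiteMoments r))]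
  congr 1
  funext k
  exact h.integral_mul_X_mul_eval hsr le_rfl hW hWf k

end Moments

/-! ### From polynomials in `X_u` to the σ-field of the future -/

section Annihilates

variable {q θ τ : ℝ} {Ω : Type*} [MeasurableSpace Ω] {P : Measure Ω} {X : ℝ≥0 → Ω → ℝ}
  {Z : Ω → ℝ} {u : ℝ≥0}

/-- `Z` has moments of all orders, is determined by the past of time `u`, and is orthogonal to all
polynomials in `X_u`, or equivalently to the basis formed by the `Q_n(X_u | 0, 0, u)`. -/
structure Annihilates (q θ τ : ℝ) (P : Measure Ω) (X : ℝ≥0 → Ω → ℝ) (u : ℝ≥0) (Z : Ω → ℝ) :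
    Prop where
  measurable : Measurable[past X u] Z
  finiteMoments : FiniteMoments P Z
  integral_mul_eval : ∀ n, ∫ ω, Z ω * (Q q θ τ 0 0 u n).eval (X u ω) ∂P = 0

variable [IsProbabilityMeasure P] (h : HasMartingalePolynomials q θ τ P X)
include h

lemma Annihilates.mono {v : ℝ≥0} (hZ : Annihilates q θ τ P X u Z) (huv : u ≤ v) :
    Annihilates q θ τ P X v Z where
  measurable := hZ.measurable.mono (past_mono huv) le_rfl
  finiteMoments := hZ.finiteMoments
  integral_mul_eval n := by
    rw [h.integral_mul_eval huv hZ.measurable hZ.finiteMoments, hZ.integral_mul_eval]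

lemma Annihilates.integral_mul_eval_mul_pow (hZ : Annihilates q θ τ P X u Z) (n k : ℕ) :
    ∫ ω, (Z ω * (Q q θ τ 0 0 u n).eval (X u ω)) * X u ω ^ k ∂P = 0 := by
  induction k generalizing n with
  | zero => simpa using hZ.integral_mul_eval n
  | succ k ih =>
    have h1 := h.integral_mul_mul_eval u
      (hZ.finiteMoments.mul ((h.finiteMoments u).pow k)) n
    have h2 : (fun i => ∫ ω, Z ω * X u ω ^ k * (Q q θ τ 0 0 u i).eval (X u ω) ∂P) = fun _ => 0 := by
      funext i
      refine Eq.trans ?_ (ih i)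
      congr 1
      funext ω
      ring
    rw [h2] at h1
    simp only [jacobi, mul_zero, add_zero] at h1
    refine Eq.trans ?_ h1
    congr 1
    funext ω
    ring

lemma Annihilates.indicator (hZ : Annihilates q θ τ P X u Z) {B : Set ℝ} (hB : MeasurableSet B) :
    Annihilates q θ τ P X u ((X u ⁻¹' B).indicator Z) where
  measurable := hZ.measurable.indicator (measurable_past le_rfl hB)
  finiteMoments := hZ.finiteMoments.indicator (h.measurable u hB)
  integral_mul_eval n := by
    have hf := hZ.finiteMoments.mul ((h.finiteMoments u).eval (Q q θ τ 0 0 u n))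
    have hm : Measurable fun ω => Z ω * (Q q θ τ 0 0 u n).eval (X u ω) :=
      (hZ.measurable.mono (h.past_le u) le_rfl).mul
        ((Polynomial.continuous _).measurable.comp (h.measurable u))
    have h1 := setIntegral_preimage_eq_zero (h.measurable u) (h.exp_moments u) hm hf.memLp_two
      (hZ.integral_mul_eval_mul_pow h n) hB
    rw [← integral_indicator (h.measurable u hB)] at h1
    refine Eq.trans ?_ h1
    congr 1
    funext ω
    by_cases hω : ω ∈ X u ⁻¹' B <;> simp [hω]

lemma Annihilates.setIntegral_biInter (hZ : Annihilates q θ τ P X u Z) (T : Finset ℝ≥0)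
    (hT : ∀ r ∈ T, u ≤ r) (B : ℝ≥0 → Set ℝ) (hB : ∀ r ∈ T, MeasurableSet (B r)) :
    ∫ ω in ⋂ r ∈ T, X r ⁻¹' B r, Z ω ∂P = 0 := by
  induction T using Finset.induction_on_min generalizing u Z with
  | empty => simpa using hZ.integral_mul_eval 0
  | insert a T haT ih =>
    have hua : u ≤ a := hT a (Finset.mem_insert_self a T)
    have hBa : MeasurableSet (B a) := hB a (Finset.mem_insert_self a T)
    have h1 := ih ((hZ.mono h hua).indicator h hBa) (fun r hr => (haT r hr).le)
      (fun r hr => hB r (Finset.mem_insert_of_mem hr))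
    rw [setIntegral_indicator (h.measurable a hBa), Set.inter_comm] at h1
    rwa [Finset.set_biInter_insert]

/-- To identify a conditional expectation given the past and the future it suffices to test against
the events of the past and the polynomials in `X_u`. -/
theorem HasMartingalePolynomials.condExp_pastFuture_ae_eq {s : ℝ≥0} (hsu : s < u) {f g : Ω → ℝ}
    (hf : Measurable[past X u] f) (hff : FiniteMoments P f)
    (hg : Measurable[pastFuture X s u] g) (hg' : Measurable[past X u] g) (hgf : FiniteMoments P g)
    (hfg : ∀ W : Ω → ℝ, Measurable[past X s] W → FiniteMoments P W → ∀ n,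
      ∫ ω, W ω * f ω * (Q q θ τ 0 0 u n).eval (X u ω) ∂P =
        ∫ ω, W ω * g ω * (Q q θ τ 0 0 u n).eval (X u ω) ∂P) :
    P[f | pastFuture X s u] =ᵐ[P] g := by
  have hle : pastFuture X s u ≤ ‹MeasurableSpace Ω› := sigmaField_le h.measurable _
  set Z : Ω → ℝ := fun ω => g ω - f ω with hZdef
  have hZf : FiniteMoments P Z := hgf.sub hff
  have hann : ∀ A, MeasurableSet[past X s] A → Annihilates q θ τ P X u (A.indicator Z) := by
    intro A hA
    refine ⟨(hg'.sub hf).indicator (past_mono hsu.le _ hA), hZf.indicator (h.past_le s _ hA),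
      fun n => ?_⟩
    have hWf : FiniteMoments P (A.indicator fun _ => (1 : ℝ)) :=
      (finiteMoments_const 1).indicator (h.past_le s _ hA)
    have h1 := hfg _ (measurable_const.indicator hA) hWf n
    have hM := (h.finiteMoments u).eval (Q q θ τ 0 0 u n)
    rw [eq_comm, ← sub_eq_zero, ← integral_sub ((hWf.mul hgf).mul hM).integrable
      ((hWf.mul hff).mul hM).integrable] at h1
    refine Eq.trans ?_ h1
    congr 1
    funext ω
    by_cases hω : ω ∈ A <;> simp [hω, hZdef, sub_mul]
  have hbasic : ∀ S ∈ piiUnionInter (fun r => {S | MeasurableSet[(borel ℝ).comap (X r)] S})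
      (Set.Iic s ∪ Set.Ici u), ∫ ω in S, Z ω ∂P = 0 := by
    rintro S ⟨T, hT, F, hF, rfl⟩
    choose! B hB hBF using hF
    have hsplit : ⋂ r ∈ T, F r = (⋂ r ∈ T.filter (fun r => ¬ r ≤ s), X r ⁻¹' B r) ∩
        ⋂ r ∈ T.filter (fun r => r ≤ s), X r ⁻¹' B r := by
      ext ω
      simp only [Set.mem_iInter, Finset.mem_filter, Set.mem_inter_iff]
      constructor
      · exact fun hω => ⟨fun r hr => by rw [hBF r hr.1]; exact hω r hr.1,
          fun r hr => by rw [hBF r hr.1]; exact hω r hr.1⟩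
      · rintro ⟨h1, h2⟩ r hr
        rw [← hBF r hr]
        by_cases hrs : r ≤ s
        · exact h2 r ⟨hr, hrs⟩
        · exact h1 r ⟨hr, hrs⟩
    have hA : MeasurableSet[past X s] (⋂ r ∈ T.filter (fun r => r ≤ s), X r ⁻¹' B r) := by
      refine Finset.measurableSet_biInter _ fun r hr => ?_
      rw [Finset.mem_filter] at hr
      exact measurable_past hr.2 (hB r hr.1)
    rw [hsplit, ← setIntegral_indicator (h.past_le s _ hA)]
    refine (hann _ hA).setIntegral_biInter h _ (fun r hr => ?_) B (fun r hr => ?_)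
    · rw [Finset.mem_filter] at hr
      exact (hT hr.1).resolve_left hr.2
    · rw [Finset.mem_filter] at hr
      exact hB r hr.1
  have hall : ∀ S, MeasurableSet[pastFuture X s u] S → ∫ ω in S, Z ω ∂P = 0 := by
    intro S hS
    have huniv : ∫ ω, Z ω ∂P = 0 := by
      rw [← setIntegral_univ]
      exact hbasic _ ⟨∅, by simp, fun _ => Set.univ, by simp, by simp⟩
    induction S, hS using MeasurableSpace.induction_on_inter
      (generateFrom_piiUnionInter_measurableSet (fun r => (borel ℝ).comap (X r))
        (Set.Iic s ∪ Set.Ici u)).symm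
      (isPiSystem_piiUnionInter _ (fun r => @MeasurableSpace.isPiSystem_measurableSet Ω
        ((borel ℝ).comap (X r))) _) with
    | empty => simp
    | basic S hS => exact hbasic S hS
    | compl S hS ih =>
      rw [setIntegral_compl (hle S hS) hZf.integrable, huniv, ih, sub_zero]
    | iUnion F hdisj hF ih =>
      rw [integral_iUnion (fun i => hle _ (hF i)) hdisj hZf.integrable.integrableOn]
      simp [ih]
  refine (ae_eq_condExp_of_forall_setIntegral_eq hle hff.integrable
    (fun _ _ _ => hgf.integrable.integrableOn) (fun S hS _ => ?_)
    hg.stronglyMeasurable.aestronglyMeasurable).symm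
  rw [← sub_eq_zero, ← integral_sub hgf.integrable.integrableOn hff.integrable.integrableOn]
  exact hall S hS

end Annihilates

/-! ### The quadratic relation between Jacobi operators -/

section Jacobi

variable {q : ℝ} (θ τ : ℝ)

lemma jacobi_interpolate (q : ℝ) {s t u : ℝ} (hsu : s < u) (m : ℕ → ℝ) (n : ℕ) :
    jacobi q θ τ t m n =
      (u - t) / (u - s) * jacobi q θ τ s m n + (t - s) / (u - s) * jacobi q θ τ u m n := by
  have h : u - s ≠ 0 := by linarith
  unfold jacobi
  field_simp
  ring

lemma denominator_pos (hq : |q| ≤ 1) {τ : ℝ} (hτ : 0 ≤ τ) {s u : ℝ} (hs : 0 ≤ s) (hsu : s < u) :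
    0 < u + τ - q * s := by
  have := (abs_le.mp hq).2
  nlinarith

/-- The operator form of the conditional second moment given the past and the future. With the
Jacobi operator written as `x + t y`, it expresses the `q`-commutation relation
`x y - q y x = 1 + θ y + τ y²`. -/
lemma jacobi_jacobi {s t u : ℝ} (hsu : s < u) (hden : u + τ - q * s ≠ 0) (m : ℕ → ℝ) (n : ℕ) :
    jacobi q θ τ t (jacobi q θ τ t m) n =
      coeffA q τ s t u * jacobi q θ τ s (jacobi q θ τ s m) n
        + coeffB q τ s t u * jacobi q θ τ u (jacobi q θ τ s m) n
        + coeffC q τ s t u * jacobi q θ τ u (jacobi q θ τ u m) n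
        + coeffD q τ s t u * m n
        + coeffAlpha q θ τ s t u * jacobi q θ τ s m n
        + coeffBeta q θ τ s t u * jacobi q θ τ u m n := by
  have h : u - s ≠ 0 := by linarith
  unfold jacobi coeffA coeffB coeffC coeffD coeffAlpha coeffBeta
  -- With the common denominator as a variable in place of `τ`, clearing denominators is immediate.
  obtain ⟨d, hd⟩ : ∃ d, u + τ - q * s = d := ⟨_, rfl⟩
  rw [hd] at hden ⊢
  obtain rfl : τ = d - u + q * s := by linarith
  rcases n with _ | _ | n
  · simp only [qInt_zero, qInt_succ', Nat.zero_sub, zero_add, Nat.sub_self, mul_zero,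
      zero_mul, add_zero]
    generalize m 0 = m0
    generalize m 1 = m1
    generalize m (1 + 1) = m2
    field_simp
    ring
  · simp only [qInt_zero, qInt_succ', zero_add, Nat.add_sub_cancel, mul_zero, zero_mul, add_zero,
      Nat.sub_self, Nat.zero_sub]
    generalize m 0 = m0
    generalize m 1 = m1
    generalize m (1 + 1) = m2
    generalize m (1 + 1 + 1) = m3
    field_simp
    ring
  · simp only [qInt_succ', Nat.add_sub_cancel]
    generalize qInt q n = N
    generalize qInt q (n - 1) = N'
    generalize m n = m0
    generalize m (n + 1) = m1
    generalize m (n + 1 + 1) = m2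
    generalize m (n + 1 + 1 + 1) = m3
    generalize m (n + 1 + 1 + 1 + 1) = m4
    field_simp
    ring

lemma coeff_sub_sq_eq {s t u : ℝ} (hsu : s < u) (hden : u + τ - q * s ≠ 0) (x y : ℝ) :
    coeffA q τ s t u * x ^ 2 + coeffB q τ s t u * (x * y) + coeffC q τ s t u * y ^ 2
        + coeffD q τ s t u + coeffAlpha q θ τ s t u * x + coeffBeta q θ τ s t u * y
        - ((u - t) / (u - s) * x + (t - s) / (u - s) * y) ^ 2 =
      (u - t) * (t - s) / (u + τ - q * s) *
        ((1 - q) * ((y - x) * (s * y - u * x) / (u - s) ^ 2) + τ * ((y - x) ^ 2 / (u - s) ^ 2)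
          + θ * ((y - x) / (u - s)) + 1) := by
  have h : u - s ≠ 0 := by linarith
  unfold coeffA coeffB coeffC coeffD coeffAlpha coeffBeta
  obtain ⟨d, hd⟩ : ∃ d, u + τ - q * s = d := ⟨_, rfl⟩
  rw [hd] at hden ⊢
  obtain rfl : τ = d - u + q * s := by linarith
  field_simp
  ring

end Jacobi

/-! ### Conditional moments -/

section ConditionalMoments

variable {q θ τ : ℝ} {Ω : Type*} [MeasurableSpace Ω] {P : Measure Ω} [IsProbabilityMeasure P]
  {X : ℝ≥0 → Ω → ℝ} (h : HasMartingalePolynomials q θ τ P X)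
include h

lemma HasMartingalePolynomials.condExp_sq_past {s t : ℝ≥0} (hst : s ≤ t) :
    P[fun ω => X t ω ^ 2 | past X s] =ᵐ[P] fun ω => X s ω ^ 2 + (t : ℝ) - (s : ℝ) := by
  have hXt := h.finiteMoments t
  have hXs := h.finiteMoments s
  have hg : FiniteMoments P fun ω => X s ω ^ 2 + (t : ℝ) - (s : ℝ) :=
    ((hXs.pow 2).add (finiteMoments_const _)).sub (finiteMoments_const _)
  have hgm : Measurable[past X s] fun ω => X s ω ^ 2 + (t : ℝ) - (s : ℝ) :=
    (((measurable_past le_rfl).pow_const 2).add_const _).sub_const _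
  refine (ae_eq_condExp_of_forall_setIntegral_eq (h.past_le s) (hXt.pow 2).integrable
    (fun _ _ _ => hg.integrable.integrableOn) (fun A hA _ => ?_)
    hgm.stronglyMeasurable.aestronglyMeasurable).symm
  set W : Ω → ℝ := A.indicator fun _ => 1 with hW
  have hWm : Measurable[past X s] W := measurable_const.indicator hA
  have hWf : FiniteMoments P W := (finiteMoments_const 1).indicator (h.past_le s _ hA)
  have hset : ∀ f : Ω → ℝ, ∫ ω in A, f ω ∂P = ∫ ω, W ω * f ω ∂P := fun f => by
    rw [← integral_indicator (h.past_le s _ hA)]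
    congr 1
    funext ω
    by_cases hω : ω ∈ A <;> simp [hW, hω]
  have ht := h.integral_mul_X_mul_X_mul_eval hst le_rfl le_rfl hWm hWf 0
  have hs := h.integral_mul_X_mul_X_mul_eval (s := s) le_rfl le_rfl le_rfl hWm hWf 0
  simp only [jacobi, qInt_zero, qInt_succ', zero_add, mul_zero, zero_mul, add_zero, Nat.sub_self,
    Q_zero, Polynomial.eval_one, mul_one, mul_assoc, ← pow_two] at ht hs
  rw [hset, hset]
  have hsplit : ∫ ω, W ω * (X s ω ^ 2 + (t : ℝ) - (s : ℝ)) ∂P =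
      ∫ ω, W ω * X s ω ^ 2 ∂P + ∫ ω, (t - s : ℝ) * W ω ∂P := by
    rw [← integral_add (hWf.mul (hXs.pow 2)).integrable (hWf.const_mul _).integrable]
    congr 1
    funext ω
    ring
  rw [hsplit, integral_const_mul, ht, hs]
  ring

lemma HasMartingalePolynomials.integral_eval_zero (n : ℕ) :
    ∫ ω, (1 : ℝ) * (Q q θ τ 0 0 (0 : ℝ≥0) n).eval (X 0 ω) ∂P =
      (Q q θ τ 0 0 (0 : ℝ≥0) n).eval 0 := by
  rw [integral_congr_ae (g := fun _ => (Q q θ τ 0 0 (0 : ℝ≥0) n).eval 0)]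
  · simp
  · filter_upwards [h.zero] with ω hω
    rw [hω, one_mul]

lemma HasMartingalePolynomials.integral_X (t : ℝ≥0) : ∫ ω, X t ω ∂P = 0 := by
  have h1 := h.integral_mul_X_mul_eval (s := 0) (zero_le : 0 ≤ t) le_rfl (W := fun _ => 1)
    measurable_const (finiteMoments_const 1) 0
  simp_rw [h.integral_eval_zero] at h1
  simpa [jacobi, Q_one] using h1

lemma HasMartingalePolynomials.integral_X_mul_X {s t : ℝ≥0} (hst : s ≤ t) :
    ∫ ω, X s ω * X t ω ∂P = s := by
  have h1 := h.integral_mul_X_mul_X_mul_eval (s := 0) (zero_le : 0 ≤ s) hst le_rfl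
    (W := fun _ => 1) measurable_const (finiteMoments_const 1) 0
  simp_rw [h.integral_eval_zero] at h1
  have hQ2 : (Q q θ τ 0 0 0 2).eval 0 = 0 := by simp [Q]
  simpa [jacobi, Q_one, hQ2, qInt] using h1

/-- The process is a linear harness. -/
theorem HasMartingalePolynomials.condExp_pastFuture {s t u : ℝ≥0} (hst : s < t) (htu : t < u) :
    P[X t | pastFuture X s u] =ᵐ[P]
      fun ω => ((u : ℝ) - t) / ((u : ℝ) - s) * X s ω + ((t : ℝ) - s) / ((u : ℝ) - s) * X u ω := by
  have hsu := hst.trans htu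
  have hXs := h.finiteMoments s
  have hXu := h.finiteMoments u
  have hms : Measurable[pastFuture X s u] (X s) :=
    measurable_sigmaField (Or.inl (Set.mem_Iic.mpr le_rfl))
  have hmu : Measurable[pastFuture X s u] (X u) :=
    measurable_sigmaField (Or.inr (Set.mem_Ici.mpr le_rfl))
  refine h.condExp_pastFuture_ae_eq hsu (measurable_past htu.le) (h.finiteMoments t)
    ((hms.const_mul _).add (hmu.const_mul _))
    (((measurable_past hsu.le).const_mul _).add ((measurable_past le_rfl).const_mul _))
    ((hXs.const_mul _).add (hXu.const_mul _)) fun W hW hWf n => ?_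
  have hM := hXu.eval (Q q θ τ 0 0 u n)
  rw [h.integral_mul_X_mul_eval hst.le htu.le hW hWf,
    jacobi_interpolate θ τ q (show (s : ℝ) < u from hsu),
    ← h.integral_mul_X_mul_eval le_rfl hsu.le hW hWf,
    ← h.integral_mul_X_mul_eval hsu.le le_rfl hW hWf,
    ← integral_const_mul, ← integral_const_mul,
    ← integral_add (((hWf.mul hXs).mul hM).const_mul _).integrable
      (((hWf.mul hXu).mul hM).const_mul _).integrable]
  congr 1
  funext ω
  ring

/-- The process is a quadratic harness. -/
theorem HasMartingalePolynomials.condExp_sq_pastFuture (hq : |q| ≤ 1) (hτ : 0 ≤ τ)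
    {s t u : ℝ≥0} (hst : s < t) (htu : t < u) :
    P[fun ω => X t ω ^ 2 | pastFuture X s u] =ᵐ[P]
      fun ω => coeffA q τ s t u * X s ω ^ 2
        + coeffB q τ s t u * (X s ω * X u ω)
        + coeffC q τ s t u * X u ω ^ 2
        + coeffD q τ s t u
        + coeffAlpha q θ τ s t u * X s ω
        + coeffBeta q θ τ s t u * X u ω := by
  have hsu := hst.trans htu
  have hXs := h.finiteMoments s
  have hXu := h.finiteMoments u
  have hmeas : ∀ m : MeasurableSpace Ω, Measurable[m] (X s) → Measurable[m] (X u) →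
      Measurable[m] fun ω => coeffA q τ s t u * X s ω ^ 2
        + coeffB q τ s t u * (X s ω * X u ω)
        + coeffC q τ s t u * X u ω ^ 2
        + coeffD q τ s t u
        + coeffAlpha q θ τ s t u * X s ω
        + coeffBeta q θ τ s t u * X u ω := fun m h1 h2 => by fun_prop
  refine h.condExp_pastFuture_ae_eq hsu ((measurable_past htu.le).pow_const 2)
    ((h.finiteMoments t).pow 2)
    (hmeas _ (measurable_sigmaField (Or.inl (Set.mem_Iic.mpr le_rfl)))
      (measurable_sigmaField (Or.inr (Set.mem_Ici.mpr le_rfl))))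
    (hmeas _ (measurable_past hsu.le) (measurable_past le_rfl))
    (((((((hXs.pow 2).const_mul _).add ((hXs.mul hXu).const_mul _)).add
      ((hXu.pow 2).const_mul _)).add (finiteMoments_const _)).add (hXs.const_mul _)).add
      (hXu.const_mul _)) fun W hW hWf n => ?_
  set M : Ω → ℝ := fun ω => (Q q θ τ 0 0 u n).eval (X u ω) with hMdef
  have hM : FiniteMoments P M := hXu.eval (Q q θ τ 0 0 u n)
  have hsplit : ∫ ω, W ω * (coeffA q τ s t u * X s ω ^ 2
        + coeffB q τ s t u * (X s ω * X u ω)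
        + coeffC q τ s t u * X u ω ^ 2
        + coeffD q τ s t u
        + coeffAlpha q θ τ s t u * X s ω
        + coeffBeta q θ τ s t u * X u ω) * M ω ∂P =
      coeffA q τ s t u * ∫ ω, (W ω * X s ω * X s ω) * M ω ∂P
        + coeffB q τ s t u * ∫ ω, (W ω * X s ω * X u ω) * M ω ∂P
        + coeffC q τ s t u * ∫ ω, (W ω * X u ω * X u ω) * M ω ∂P
        + coeffD q τ s t u * ∫ ω, W ω * M ω ∂P
        + coeffAlpha q θ τ s t u * ∫ ω, (W ω * X s ω) * M ω ∂P
        + coeffBeta q θ τ s t u * ∫ ω, (W ω * X u ω) * M ω ∂P := by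
    have f1 := (((hWf.mul hXs).mul hXs).mul hM).const_mul (coeffA q τ s t u)
    have f2 := (((hWf.mul hXs).mul hXu).mul hM).const_mul (coeffB q τ s t u)
    have f3 := (((hWf.mul hXu).mul hXu).mul hM).const_mul (coeffC q τ s t u)
    have f4 := (hWf.mul hM).const_mul (coeffD q τ s t u)
    have f5 := ((hWf.mul hXs).mul hM).const_mul (coeffAlpha q θ τ s t u)
    have f6 := ((hWf.mul hXu).mul hM).const_mul (coeffBeta q θ τ s t u)
    simp only [← integral_const_mul]
    rw [← integral_add f1.integrable f2.integrable,
      ← integral_add (f1.add f2).integrable f3.integrable,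
      ← integral_add ((f1.add f2).add f3).integrable f4.integrable,
      ← integral_add (((f1.add f2).add f3).add f4).integrable f5.integrable,
      ← integral_add ((((f1.add f2).add f3).add f4).add f5).integrable f6.integrable]
    congr 1
    funext ω
    ring
  have hleft : ∫ ω, W ω * X t ω ^ 2 * M ω ∂P = ∫ ω, (W ω * X t ω * X t ω) * M ω ∂P := by
    congr 1
    funext ω
    ring
  rw [hsplit, hleft, h.integral_mul_X_mul_X_mul_eval hst.le le_rfl htu.le hW hWf,
    h.integral_mul_X_mul_X_mul_eval le_rfl le_rfl hsu.le hW hWf,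
    h.integral_mul_X_mul_X_mul_eval le_rfl hsu.le le_rfl hW hWf,
    h.integral_mul_X_mul_X_mul_eval hsu.le le_rfl le_rfl hW hWf,
    h.integral_mul_X_mul_eval le_rfl hsu.le hW hWf,
    h.integral_mul_X_mul_eval hsu.le le_rfl hW hWf,
    h.integral_mul_eval hsu.le hW hWf]
  exact jacobi_jacobi θ τ (show (s : ℝ) < u from hsu)
    (denominator_pos hq hτ s.2 (show (s : ℝ) < u from hsu)).ne' _ n

theorem HasMartingalePolynomials.condVar_pastFuture (hq : |q| ≤ 1) (hτ : 0 ≤ τ)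
    {s t u : ℝ≥0} (hst : s < t) (htu : t < u) :
    Var[X t; P | pastFuture X s u] =ᵐ[P]
      fun ω => ((u : ℝ) - t) * ((t : ℝ) - s) / ((u : ℝ) + τ - q * s) *
        ((1 - q) * ((X u ω - X s ω) * ((s : ℝ) * X u ω - (u : ℝ) * X s ω) / ((u : ℝ) - s) ^ 2)
          + τ * ((X u ω - X s ω) ^ 2 / ((u : ℝ) - s) ^ 2)
          + θ * ((X u ω - X s ω) / ((u : ℝ) - s)) + 1) := by
  have hsu : (s : ℝ) < u := hst.trans htu
  have hden := (denominator_pos hq hτ s.2 hsu).ne'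
  filter_upwards [condVar_ae_eq_condExp_sq_sub_sq_condExp (sigmaField_le h.measurable _)
    (h.finiteMoments t).memLp_two, h.condExp_pastFuture hst htu,
    h.condExp_sq_pastFuture hq hτ hst htu] with ω h1 h2 h3
  rw [h1]
  change P[fun ω => X t ω ^ 2 | pastFuture X s u] ω - (P[X t | pastFuture X s u] ω) ^ 2 = _
  rw [h2, h3]
  exact coeff_sub_sq_eq θ τ hsu hden _ _

end ConditionalMoments

end QMeixner

theorem mainTheorem4 (q θ τ : ℝ) (hq : -1 ≤ q) (hq' : q ≤ 1) (hτ : 0 ≤ τ)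
    {Ω : Type*} [MeasurableSpace Ω] (P : Measure Ω) [IsProbabilityMeasure P]
    (X : ℝ≥0 → Ω → ℝ)
    (hX : QMeixner.IsMarkovFromZero P X
      (fun s t x => QMeixner.transitionMeasure q θ τ x (s : ℝ) (t : ℝ))) :
    -- square integrability, mean and covariance
    ((∀ t : ℝ≥0, MemLp (X t) 2 P) ∧
      (∀ t : ℝ≥0, ∫ ω, X t ω ∂P = 0) ∧
      (∀ s t : ℝ≥0, ∫ ω, X t ω * X s ω ∂P = min (t : ℝ) (s : ℝ))) ∧
    -- linear conditional expectations
    (∀ s t u : ℝ≥0, s < t → t < u →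
      P[X t | QMeixner.pastFuture X s u] =ᵐ[P]
        fun ω => ((u : ℝ) - t) / ((u : ℝ) - s) * X s ω + ((t : ℝ) - s) / ((u : ℝ) - s) * X u ω) ∧
    -- conditional second moment given the past
    (∀ s t : ℝ≥0, s ≤ t →
      P[fun ω => X t ω ^ 2 | QMeixner.past X s] =ᵐ[P]
        fun ω => X s ω ^ 2 + (t : ℝ) - (s : ℝ)) ∧
    -- conditional variance given the past and the future
    (∀ s t u : ℝ≥0, s < t → t < u →
      Var[X t; P | QMeixner.pastFuture X s u] =ᵐ[P]
        fun ω => ((u : ℝ) - t) * ((t : ℝ) - s) / ((u : ℝ) + τ - q * s) *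
          ((1 - q) * ((X u ω - X s ω) * ((s : ℝ) * X u ω - (u : ℝ) * X s ω) / ((u : ℝ) - s) ^ 2)
            + τ * ((X u ω - X s ω) ^ 2 / ((u : ℝ) - s) ^ 2)
            + θ * ((X u ω - X s ω) / ((u : ℝ) - s)) + 1)) ∧
    -- the same as a formula for the conditional second moment, with explicit coefficients
    (∀ s t u : ℝ≥0, s < t → t < u →
      P[fun ω => X t ω ^ 2 | QMeixner.pastFuture X s u] =ᵐ[P]
        fun ω => QMeixner.coeffA q τ s t u * X s ω ^ 2
          + QMeixner.coeffB q τ s t u * (X s ω * X u ω)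
          + QMeixner.coeffC q τ s t u * X u ω ^ 2
          + QMeixner.coeffD q τ s t u
          + QMeixner.coeffAlpha q θ τ s t u * X s ω
          + QMeixner.coeffBeta q θ τ s t u * X u ω) := by
  have hq1 : |q| ≤ 1 := abs_le.mpr ⟨hq, hq'⟩
  have h := hX.hasMartingalePolynomials hq1 hτ
  refine ⟨⟨fun t => (h.finiteMoments t).memLp_two, h.integral_X, fun s t => ?_⟩,
    fun s t u hst htu => h.condExp_pastFuture hst htu, fun s t hst => h.condExp_sq_past hst,
    fun s t u hst htu => h.condVar_pastFuture hq1 hτ hst htu,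
    fun s t u hst htu => h.condExp_sq_pastFuture hq1 hτ hst htu⟩
  rcases le_total s t with hst | hts
  · rw [min_eq_right (NNReal.coe_le_coe.mpr hst), ← h.integral_X_mul_X hst]
    simp_rw [mul_comm]
  · rw [min_eq_left (NNReal.coe_le_coe.mpr hts), h.integral_X_mul_X hts]
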